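/- An abstract polyhedron is a partially ordered set with elements of rank $0$ (vertices), $1$ (edges) and $2$ (faces) such that: every edge is incident to exactly two vertices and exactly two faces; whenever a vertex is incident to a face, exactly two edges are incident to both; the graph of the incidence relation ($F\le G$ or $G\le F$) is connected; and for every vertex or face $F$, the subgraph of that graph induced by the neighbors of $F$ (not including $F$) is connected. A flag is a vertex, an edge and a face that are mutually incident; two flags are adjacent if they differ in exactly one element. The polyhedron is of type $\{p,q\}$ if every face is a $p$-gon (incident to exactly $p$ edges and $p$ vertices) and every vertex-figure is a $q$-gon (every vertex is incident to exactly $q$ edges and $q$ faces); a polyhedron of type $\{p,q\}$ is tight if it has exactly $2pq$ flags. It is chiral if its flags are partitioned into two classes such that its group of (order-preserving) automorphisms acts transitively on each class but not on the set of all flags, and adjacent flags always lie in different classes. **Theorem.** Let $m$ be an odd prime, and let $r$ and $s$ be positive integers such that either $s$ is even, or $s$ is odd and $r$ divides $sm$. Then there exists a tight chiral polyhedron of type $\{2rm, sm^2\}$. -/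

import Mathlib

namespace AbsPoly

/-- The graph of the incidence relation of a ranked poset: two distinct elements `F` and `G` are
joined when they are incident, that is, when `F ≤ G` or `G ≤ F`. -/
def incidenceGraph (P : Type*) [PartialOrder P] : SimpleGraph P :=
  SimpleGraph.fromRel (fun F G : P => F ≤ G)

/-- The elements of rank `i` that are incident to `F` and different from `F`. -/
def incidentOfRank {P : Type*} [PartialOrder P] [GradeOrder (Fin 3) P] (i : Fin 3) (F : P) :
    Set P :=
  {G | grade (Fin 3) G = i ∧ (incidenceGraph P).Adj F G}

/-- Abstract polyhedra. The ranked poset is given by an order with a grading in `{0, 1, 2}`; the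
elements of rank `0`, `1`, `2` are the vertices, the edges and the faces. -/
structure IsPolyhedron (P : Type*) [PartialOrder P] [GradeOrder (Fin 3) P] : Prop where
  /-- Every edge is incident to exactly two vertices. -/
  edge_vertices : ∀ e : P, grade (Fin 3) e = 1 → (incidentOfRank 0 e).encard = 2
  /-- Every edge is incident to exactly two faces. -/
  edge_faces : ∀ e : P, grade (Fin 3) e = 1 → (incidentOfRank 2 e).encard = 2
  /-- If a vertex is incident to a face, exactly two edges are incident to both. -/
  diamond : ∀ v f : P, grade (Fin 3) v = 0 → grade (Fin 3) f = 2 →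
    (incidenceGraph P).Adj v f → (incidentOfRank 1 v ∩ incidentOfRank 1 f).encard = 2
  /-- The graph of the incidence relation is connected. -/
  connected : (incidenceGraph P).Connected
  /-- For any vertex or face `F`, the neighbours of `F` induce a connected subgraph. -/
  link_connected : ∀ F : P, grade (Fin 3) F = 0 ∨ grade (Fin 3) F = 2 →
    ((incidenceGraph P).induce ((incidenceGraph P).neighborSet F)).Connected

/-- A flag: a vertex, an edge and a face that are mutually incident (`elem i` has rank `i`). -/
@[ext]
structure PFlag (P : Type*) [PartialOrder P] [GradeOrder (Fin 3) P] where
  /-- the element of rank `i` of the flag -/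
  elem : Fin 3 → P
  grade_elem : ∀ i, grade (Fin 3) (elem i) = i
  incident : ∀ i j, elem i ≤ elem j ∨ elem j ≤ elem i

section

variable {P : Type*} [PartialOrder P] [GradeOrder (Fin 3) P]

/-- Two flags are adjacent when they differ in exactly one element. -/
def PFlag.Adjacent (Φ Ψ : PFlag P) : Prop :=
  ∃ i, Φ.elem i ≠ Ψ.elem i ∧ ∀ j, j ≠ i → Φ.elem j = Ψ.elem j

/-- Some automorphism of the poset sends the flag `Φ` to the flag `Ψ`. -/
def PFlag.Equivalent (Φ Ψ : PFlag P) : Prop :=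
  ∃ g : P ≃o P, ∀ i, g (Φ.elem i) = Ψ.elem i

end

/-- Chirality: the flags fall into two classes, such that the automorphism group acts on each
class transitively, but not transitively on the set of all flags, and such that adjacent flags
lie in different classes. The classes are `C` and its complement. -/
def IsChiral (P : Type*) [PartialOrder P] [GradeOrder (Fin 3) P] : Prop :=
  ∃ C : Set (PFlag P),
    (∀ Φ Ψ : PFlag P, Φ.Equivalent Ψ ↔ (Φ ∈ C ↔ Ψ ∈ C)) ∧
    (¬ ∀ Φ Ψ : PFlag P, Φ.Equivalent Ψ) ∧
    ∀ Φ Ψ : PFlag P, Φ.Adjacent Ψ → (Φ ∈ C ↔ Ψ ∉ C)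

/-- Schläfli symbol `{p, q}`: every face is incident to exactly `p` edges and `p` vertices, and
every vertex is incident to exactly `q` edges and `q` faces. For a polyhedron these elements
automatically occur in a single cycle, since the link is connected and, by the axioms, each of its
elements is incident to exactly two others in the link. -/
def HasSchlafliSymbol (P : Type*) [PartialOrder P] [GradeOrder (Fin 3) P] (p q : ℕ) : Prop :=
  (∀ f : P, grade (Fin 3) f = 2 →
    (incidentOfRank 1 f).encard = p ∧ (incidentOfRank 0 f).encard = p) ∧
  (∀ v : P, grade (Fin 3) v = 0 →
    (incidentOfRank 1 v).encard = q ∧ (incidentOfRank 2 v).encard = q)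

/-- Tightness: for the Schläfli symbol `{p, q}`, there are exactly `2pq` flags. -/
def IsTight (P : Type*) [PartialOrder P] [GradeOrder (Fin 3) P] : Prop :=
  ∃ p q : ℕ, HasSchlafliSymbol P p q ∧ ENat.card (PFlag P) = ((2 * p * q : ℕ) : ℕ∞)

end AbsPoly

/-! A tight polyhedron whose automorphisms include all rotations comes from a group `G` with
generators `a`, `b` of orders `p`, `q` such that `(a * b) ^ 2 = 1`, `⟨a⟩ ∩ ⟨b⟩ = 1` and `G =
⟨a⟩⟨b⟩`. Vertices, edges and faces are the left cosets of `⟨b⟩`, `⟨a * b⟩` and `⟨a⟩`, incident when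
they meet. The factorization gives `|G| = pq`, and each group element carries two flags, an even and
an odd one, so there are `2pq` flags. `G` is transitive on each class; an automorphism mixing the
classes would yield a map `f` on `G` with `f (g * a) = f g * a⁻¹` and `f (g * b) = f g * b⁻¹`. Hence
one relation between `a` and `b` that breaks when all exponents are negated forces chirality
(`HasAsymmetricRelation.noInversion`, `IsTightPair.isChiral`).

Such a group of type `{2M, N}`, with `N` odd, acts on `ZMod N`. Take `E = N / m` with `E ^ 2 = 0`;
then `a` is `x ↦ -(1 + E) x` and `b` is `x ↦ (1 - E)(x - 1)`, each paired with an element of `ZMod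
M` that raises the order of `a` to `2M`. Since `E ^ 2 = 0`, all powers have closed forms, from which
`ChiralData.isPermutingPair` and `ChiralData.hasAsymmetricRelation` follow by computation.

For odd `s` this is enough. For even `s`, the parts of `r` and `s` prime to `m` are supplied by
mixing with a regular polyhedron of type `{2u, 2v}` (`IsPermutingPair.prod`), after dualizing if `r`
contains too high a power of `m`. -/

section CosetPoset

/-! ### Coset geometries of three subgroups -/

open AbsPoly

variable {G : Type} [Group G]

/-- The elements of the coset geometry of three subgroups: the elements of rank `i` are the left
cosets of `H i`. -/
structure CosetElem (H : Fin 3 → Subgroup G) where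
  /-- the rank of the element -/
  rank : Fin 3
  /-- the coset -/
  coset : G ⧸ H rank

/-- The left coset of `H i` that contains `g`, as an element of the coset geometry. -/
def CosetElem.of (H : Fin 3 → Subgroup G) (i : Fin 3) (g : G) : CosetElem H := ⟨i, (g : G ⧸ H i)⟩

/-- The vertex and the face through any group elements have a common element. -/
class IsFlatTriple (H : Fin 3 → Subgroup G) : Prop where
  exists_mul_eq : ∀ g : G, ∃ x ∈ H 0, ∃ y ∈ H 2, g = x * y

namespace CosetElem

variable {H : Fin 3 → Subgroup G}

@[simp] theorem rank_of (i : Fin 3) (g : G) : (of H i g).rank = i := rfl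

theorem exists_of (x : CosetElem H) : ∃ g, x = of H x.rank g := by
  obtain ⟨i, c⟩ := x
  obtain ⟨g, rfl⟩ := QuotientGroup.mk_surjective c
  exact ⟨g, rfl⟩

theorem of_eq_of {i : Fin 3} {g h : G} : of H i g = of H i h ↔ g⁻¹ * h ∈ H i := by
  rw [← QuotientGroup.eq]
  simp [of]

/-- Two elements meet when their cosets have a common element. -/
def Meets (x y : CosetElem H) : Prop := ∃ g, x = of H x.rank g ∧ y = of H y.rank g

theorem Meets.symm {x y : CosetElem H} (h : Meets x y) : Meets y x := by
  obtain ⟨g, h1, h2⟩ := h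
  exact ⟨g, h2, h1⟩

theorem meets_of_of (i j : Fin 3) (g : G) : Meets (of H i g) (of H j g) := ⟨g, rfl, rfl⟩

theorem meets_of_iff {i : Fin 3} {g : G} {y : CosetElem H} :
    Meets (of H i g) y ↔ ∃ h ∈ H i, y = of H y.rank (g * h) := by
  constructor
  · rintro ⟨k, h1, h2⟩
    exact ⟨g⁻¹ * k, of_eq_of.1 h1, by simpa using h2⟩
  · rintro ⟨h, h1, h2⟩
    exact ⟨g * h, of_eq_of.2 (by simpa using h1), h2⟩

variable [IsFlatTriple H]

theorem meets_of_zero_two (g h : G) : Meets (of H 0 g) (of H 2 h) := by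
  obtain ⟨x, hx, y, hy, e⟩ := IsFlatTriple.exists_mul_eq (H := H) (g⁻¹ * h)
  refine ⟨g * x, of_eq_of.2 (by simpa using hx), of_eq_of.2 ?_⟩
  have : h⁻¹ * (g * x) = y⁻¹ := by
    have : h = g * (x * y) := by rw [← e]; group
    rw [this]; group
  simp only [this]
  exact inv_mem hy

theorem meets_of_rank {x y : CosetElem H} (hx : x.rank = 0) (hy : y.rank = 2) : Meets x y := by
  obtain ⟨g, h1⟩ := x.exists_of
  obtain ⟨h, h2⟩ := y.exists_of
  rw [h1, h2, hx, hy]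
  exact meets_of_zero_two g h

/-- Meeting is not transitive in general. Only a chain of ranks 0, 1, 2 is at stake, and flatness
makes every vertex meet every face. -/
instance : PartialOrder (CosetElem H) where
  le x y := x = y ∨ (x.rank < y.rank ∧ Meets x y)
  le_refl x := Or.inl rfl
  le_trans x y z := by
    rintro (rfl | ⟨h1, m1⟩) (rfl | ⟨h2, m2⟩)
    · exact Or.inl rfl
    · exact Or.inr ⟨h2, m2⟩
    · exact Or.inr ⟨h1, m1⟩
    · exact Or.inr ⟨h1.trans h2, meets_of_rank (by omega) (by omega)⟩
  le_antisymm x y := by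
    rintro (rfl | ⟨h1, m1⟩) (h | ⟨h2, m2⟩)
    · rfl
    · rfl
    · exact h.symm
    · exact absurd h1 (asymm h2)

theorem le_iff {x y : CosetElem H} : x ≤ y ↔ x = y ∨ (x.rank < y.rank ∧ Meets x y) := Iff.rfl

theorem lt_iff {x y : CosetElem H} : x < y ↔ x.rank < y.rank ∧ Meets x y := by
  rw [lt_iff_le_and_ne, le_iff]
  constructor
  · rintro ⟨h | h, h'⟩
    · exact absurd h h'
    · exact h
  · intro h
    exact ⟨Or.inr h, fun e => by rw [e] at h; exact lt_irrefl _ h.1⟩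

instance : GradeOrder (Fin 3) (CosetElem H) where
  grade := rank
  grade_strictMono x y h := (lt_iff.1 h).1
  covBy_grade x y h := by
    obtain ⟨hr, g, h1, h2⟩ := lt_iff.1 h.1
    refine ⟨hr, fun c hc1 hc2 => ?_⟩
    refine h.2 (c := of H c g) (lt_iff.2 ⟨hc1, ?_⟩) (lt_iff.2 ⟨hc2, ?_⟩)
    · rw [h1]; exact meets_of_of _ _ _
    · rw [h2]; exact meets_of_of _ _ _

theorem grade_eq (x : CosetElem H) : grade (Fin 3) x = x.rank := rfl

theorem adj_iff {x y : CosetElem H} :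
    (incidenceGraph (CosetElem H)).Adj x y ↔ x.rank ≠ y.rank ∧ Meets x y := by
  simp only [incidenceGraph, SimpleGraph.fromRel_adj, le_iff]
  constructor
  · rintro ⟨h, (h1 | h1) | (h1 | h1)⟩
    · exact absurd h1 h
    · exact ⟨h1.1.ne, h1.2⟩
    · exact absurd h1.symm h
    · exact ⟨h1.1.ne', h1.2.symm⟩
  · rintro ⟨h, m⟩
    refine ⟨fun e => h (by rw [e]), ?_⟩
    rcases lt_or_gt_of_ne h with h | h
    · exact Or.inl (Or.inr ⟨h, m⟩)
    · exact Or.inr (Or.inr ⟨h, m.symm⟩)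

theorem adj_of {i j : Fin 3} (hij : i ≠ j) (g : G) :
    (incidenceGraph (CosetElem H)).Adj (of H i g) (of H j g) :=
  adj_iff.2 ⟨hij, meets_of_of i j g⟩

theorem incidentOfRank_of {i j : Fin 3} (hij : i ≠ j) (g : G) :
    incidentOfRank j (of H i g) = Set.range fun h : H i => of H j (g * h) := by
  ext y
  simp only [incidentOfRank, Set.mem_ofPred_eq, adj_iff, grade_eq, Set.mem_range, meets_of_iff,
    rank_of]
  constructor
  · rintro ⟨rfl, -, h, hh, e⟩
    exact ⟨⟨h, hh⟩, e.symm⟩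
  · rintro ⟨⟨h, hh⟩, rfl⟩
    exact ⟨rfl, hij, h, hh, rfl⟩

/-- The coset `g * H i` maps onto the incident cosets of `H j`, and two of its elements in one such
coset differ by an element of `H i ∩ H j = 1`. -/
theorem encard_incidentOfRank {i j : Fin 3} (hij : i ≠ j) (hd : Disjoint (H i) (H j)) (g : G) :
    (incidentOfRank j (of H i g)).encard = ENat.card (H i) := by
  rw [incidentOfRank_of hij, Set.encard, ENat.card_congr (Equiv.ofInjective _ ?_).symm]
  intro x y h
  have h1 := of_eq_of.1 h
  have h2 : (x : G)⁻¹ * y = (g * x)⁻¹ * (g * y) := by group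
  rw [← h2] at h1
  have h3 := Subgroup.disjoint_def.1 hd ((H i).mul_mem ((H i).inv_mem x.2) y.2) h1
  exact Subtype.ext (inv_mul_eq_one.1 h3)

end CosetElem

end CosetPoset

/-! ### Rotation pairs and their stabilizers -/

section TightPair

open AbsPoly

variable {G : Type} [Group G]

/-- Rotations `a` and `b` of orders `p` and `q` whose product is an involution, and whose powers
meet trivially. -/
structure IsRotationPair (a b : G) (p q : ℕ) : Prop where
  orderOf_left : orderOf a = p
  orderOf_right : orderOf b = q
  one_lt_left : 1 < p
  one_lt_right : 1 < q
  mul_sq : (a * b) ^ 2 = 1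
  disjoint : ∀ i j : ℤ, a ^ i = b ^ j → a ^ i = 1

/-- A rotation pair such that each element of the group is a power of the first rotation times a
power of the second. -/
structure IsTightPair (a b : G) (p q : ℕ) : Prop extends IsRotationPair a b p q where
  exists_zpow : ∀ g : G, ∃ i j : ℤ, g = a ^ i * b ^ j

/-- The stabilizers of the base vertex, the base edge and the base face. -/
def rotationStabilizer (a b : G) : Fin 3 → Subgroup G :=
  ![Subgroup.zpowers b, Subgroup.zpowers (a * b), Subgroup.zpowers a]

namespace IsRotationPair

variable {a b : G} {p q : ℕ} (hT : IsRotationPair a b p q)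
include hT

theorem left_ne_one : a ≠ 1 := by
  rintro rfl
  have := hT.orderOf_left
  have := hT.one_lt_left
  simp at *
  omega

theorem right_ne_one : b ≠ 1 := by
  rintro rfl
  have := hT.orderOf_right
  have := hT.one_lt_right
  simp at *
  omega

theorem disjoint_zpowers : Disjoint (Subgroup.zpowers b) (Subgroup.zpowers a) := by
  rw [Subgroup.disjoint_def]
  rintro x ⟨j, rfl⟩ ⟨i, h⟩
  have h : a ^ i = b ^ j := h
  have := hT.disjoint i j h
  simpa [← h] using this

theorem left_notMem : a ∉ Subgroup.zpowers b := fun h =>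
  hT.left_ne_one (Subgroup.disjoint_def.1 hT.disjoint_zpowers h (Subgroup.mem_zpowers a))

theorem right_notMem : b ∉ Subgroup.zpowers a := fun h =>
  hT.right_ne_one (Subgroup.disjoint_def.1 hT.disjoint_zpowers (Subgroup.mem_zpowers b) h)

theorem mul_mul_mul : a * b * (a * b) = 1 := by rw [← sq, hT.mul_sq]

theorem mem_zpowers_mul {x : G} : x ∈ Subgroup.zpowers (a * b) ↔ x = 1 ∨ x = a * b := by
  constructor
  · rintro ⟨k, rfl⟩
    obtain ⟨k, rfl | rfl⟩ := k.even_or_odd'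
    · left
      have := hT.mul_sq
      simp only [zpow_mul]
      rw [show ((a * b) ^ (2 : ℤ)) = 1 from by exact_mod_cast this, one_zpow]
    · right
      have := hT.mul_sq
      simp only [zpow_add, zpow_mul]
      rw [show ((a * b) ^ (2 : ℤ)) = 1 from by exact_mod_cast this, one_zpow, zpow_one, one_mul]
  · rintro (rfl | rfl)
    · exact one_mem _
    · exact Subgroup.mem_zpowers _

theorem mul_notMem_left : a * b ∉ Subgroup.zpowers a := fun h =>
  hT.right_notMem ((Subgroup.mul_mem_cancel_left _ (Subgroup.mem_zpowers a)).1 h)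

theorem mul_notMem_right : a * b ∉ Subgroup.zpowers b := fun h =>
  hT.left_notMem ((Subgroup.mul_mem_cancel_right _ (Subgroup.mem_zpowers b)).1 h)

theorem mul_ne_one : a * b ≠ 1 := fun h => hT.mul_notMem_left (h ▸ one_mem _)

theorem rotationStabilizer_disjoint {i j : Fin 3} (hij : i ≠ j) :
    Disjoint (rotationStabilizer a b i) (rotationStabilizer a b j) := by
  have h1 : Disjoint (Subgroup.zpowers (a * b)) (Subgroup.zpowers a) := by
    rw [Subgroup.disjoint_def]
    intro x hx hxa
    rcases hT.mem_zpowers_mul.1 hx with rfl | rfl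
    · rfl
    · exact absurd hxa hT.mul_notMem_left
  have h2 : Disjoint (Subgroup.zpowers (a * b)) (Subgroup.zpowers b) := by
    rw [Subgroup.disjoint_def]
    intro x hx hxa
    rcases hT.mem_zpowers_mul.1 hx with rfl | rfl
    · rfl
    · exact absurd hxa hT.mul_notMem_right
  have h3 := hT.disjoint_zpowers
  fin_cases i <;> fin_cases j
  exacts [absurd rfl hij, h2.symm, h3, h2, absurd rfl hij, h1, h3.symm, h1.symm, absurd rfl hij]

theorem orderOf_mul : orderOf (a * b) = 2 := orderOf_eq_prime hT.mul_sq hT.mul_ne_one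

theorem enatCard_rotationStabilizer (i : Fin 3) :
    ENat.card (rotationStabilizer a b i) = (![q, 2, p] i : ℕ) := by
  have key : ∀ x : G, 0 < orderOf x → ENat.card (Subgroup.zpowers x) = (orderOf x : ℕ) := by
    intro x hx
    have : Finite (Subgroup.zpowers x) := Nat.finite_of_card_ne_zero (by
      rw [Nat.card_zpowers]; exact hx.ne')
    rw [ENat.card_eq_coe_natCard, Nat.card_zpowers]
  have hp := hT.one_lt_left
  have hq := hT.one_lt_right
  fin_cases i
  · have := key b (by rw [hT.orderOf_right]; omega)
    rwa [hT.orderOf_right] at this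
  · have := key (a * b) (by rw [hT.orderOf_mul]; omega)
    rwa [hT.orderOf_mul] at this
  · have := key a (by rw [hT.orderOf_left]; omega)
    rwa [hT.orderOf_left] at this

theorem encard_incidentOfRank [IsFlatTriple (rotationStabilizer a b)] {i j : Fin 3} (hij : i ≠ j)
    {x : CosetElem (rotationStabilizer a b)} (hx : x.rank = i) :
    (incidentOfRank j x).encard = (![q, 2, p] i : ℕ) := by
  obtain ⟨g, h⟩ := x.exists_of
  rw [h, hx, CosetElem.encard_incidentOfRank hij (hT.rotationStabilizer_disjoint hij),
    hT.enatCard_rotationStabilizer]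

end IsRotationPair

namespace IsTightPair

variable {a b : G} {p q : ℕ} (hT : IsTightPair a b p q)
include hT

theorem isFlatTriple : IsFlatTriple (rotationStabilizer a b) := by
  constructor
  intro g
  obtain ⟨i, j, h⟩ := hT.exists_zpow g⁻¹
  refine ⟨b ^ (-j), ⟨_, rfl⟩, a ^ (-i), ⟨_, rfl⟩, ?_⟩
  rw [← inv_inv g, h]
  group

theorem symm : IsTightPair b a q p where
  orderOf_left := hT.orderOf_right
  orderOf_right := hT.orderOf_left
  one_lt_left := hT.one_lt_right
  one_lt_right := hT.one_lt_left
  mul_sq := by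
    have h := hT.mul_mul_mul
    have : a * (b * a * (b * a)) = a * 1 := by
      rw [mul_one]
      calc a * (b * a * (b * a)) = a * b * (a * b) * a := by group
        _ = a := by rw [h, one_mul]
    rw [sq]
    exact mul_left_cancel this
  disjoint i j h := by rw [h]; exact hT.disjoint j i h.symm
  exists_zpow g := by
    obtain ⟨i, j, h⟩ := hT.exists_zpow g⁻¹
    refine ⟨-j, -i, ?_⟩
    rw [← inv_inv g, h]
    group

theorem enatCard : ENat.card G = (p * q : ℕ) := by
  have hp := hT.one_lt_left
  have hq := hT.one_lt_right
  have hb : Function.Bijective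
      (fun x : Subgroup.zpowers a × Subgroup.zpowers b => (x.1 : G) * x.2) := by
    constructor
    · exact Subgroup.mul_injective_of_disjoint hT.disjoint_zpowers.symm
    · intro g
      obtain ⟨i, j, h⟩ := hT.exists_zpow g
      exact ⟨(⟨a ^ i, i, rfl⟩, ⟨b ^ j, j, rfl⟩), h.symm⟩
  have h0 := hT.enatCard_rotationStabilizer 0
  have h2 := hT.enatCard_rotationStabilizer 2
  simp only [rotationStabilizer, Matrix.cons_val_zero, Matrix.cons_val_two] at h0 h2
  rw [← ENat.card_congr (Equiv.ofBijective _ hb), ENat.card_prod]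
  simp at h0 h2
  simp [h0, h2]

end IsTightPair

end TightPair

/-! ### The tight polyhedron of a tight pair -/

section TightPolyhedron

open AbsPoly

variable {G : Type} [Group G]

open CosetElem

namespace IsTightPair

variable {a b : G} {p q : ℕ} (hT : IsTightPair a b p q)
include hT

omit hT in
theorem of_one_mul (g : G) :
    of (rotationStabilizer a b) 1 (g * (a * b)) = of (rotationStabilizer a b) 1 g :=
  of_eq_of.2 ⟨-1, by simp [mul_assoc]⟩

omit hT in
theorem of_zero_mul (g : G) (k : ℤ) :
    of (rotationStabilizer a b) 0 (g * b ^ k) = of (rotationStabilizer a b) 0 g :=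
  of_eq_of.2 ⟨-k, by simp⟩

omit hT in
theorem of_two_mul (g : G) (k : ℤ) :
    of (rotationStabilizer a b) 2 (g * a ^ k) = of (rotationStabilizer a b) 2 g :=
  of_eq_of.2 ⟨-k, by simp⟩

theorem right_mul_mul : b * (a * b) = a⁻¹ := by
  rw [eq_inv_iff_mul_eq_one]
  have h2 := hT.symm.mul_mul_mul
  rw [← h2]; group

theorem right_inv_eq : b⁻¹ = a * b * a := by
  rw [inv_eq_iff_mul_eq_one]
  have h2 := hT.symm.mul_mul_mul
  rw [← h2]; group

variable [IsFlatTriple (rotationStabilizer a b)]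

theorem incidentOfRank_edge {j : Fin 3} (hj : j ≠ 1) (g : G) :
    incidentOfRank j (of (rotationStabilizer a b) 1 g) =
      {of (rotationStabilizer a b) j g, of (rotationStabilizer a b) j (g * (a * b))} := by
  rw [incidentOfRank_of hj.symm]
  ext y
  simp only [Set.mem_range, Set.mem_insert_iff, Set.mem_singleton_iff, Subtype.exists]
  constructor
  · rintro ⟨x, hx, rfl⟩
    rcases hT.mem_zpowers_mul.1 hx with rfl | rfl <;> simp
  · rintro (rfl | rfl)
    · exact ⟨1, one_mem _, by simp⟩
    · exact ⟨a * b, Subgroup.mem_zpowers _, rfl⟩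

/-- A common edge passes through some `g * b ^ k` and some `g * a ^ l`, which differ by `1` or `a *
b`. So `a ^ l = b ^ k` or `a ^ (l + 1) = b ^ (k - 1)`, and trivial intersection leaves `b ^ k = 1`
or `b ^ k = b`. -/
theorem incidentOfRank_inter (g : G) :
    incidentOfRank 1 (of (rotationStabilizer a b) 0 g) ∩
      incidentOfRank 1 (of (rotationStabilizer a b) 2 g) =
      {of (rotationStabilizer a b) 1 g, of (rotationStabilizer a b) 1 (g * b)} := by
  rw [incidentOfRank_of (by decide), incidentOfRank_of (by decide)]
  ext y
  simp only [Set.mem_inter_iff, Set.mem_range, Set.mem_insert_iff, Set.mem_singleton_iff,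
    Subtype.exists]
  constructor
  · rintro ⟨⟨x, ⟨k, rfl⟩, rfl⟩, ⟨x, ⟨l, rfl⟩, h⟩⟩
    obtain h1 := of_eq_of.1 h
    have h1 : (g * a ^ l)⁻¹ * (g * b ^ k) ∈ Subgroup.zpowers (a * b) := h1
    change of _ 1 (g * b ^ k) = _ ∨ of _ 1 (g * b ^ k) = _
    rcases hT.mem_zpowers_mul.1 h1 with h1 | h1
    · have h2 : a ^ l = b ^ k := by rw [inv_mul_eq_one] at h1; exact mul_left_cancel h1
      left
      rw [← h2, hT.disjoint _ _ h2, mul_one]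
    · have h2 : a ^ (l + 1) = b ^ (k - 1) := by
        have h3 : a ^ l * (a * b) = b ^ k := by rw [← h1]; group
        rw [zpow_sub_one, ← h3, zpow_add_one]; group
      right
      have h3 := hT.disjoint _ _ h2
      rw [h2] at h3
      have : b ^ k = b := by
        rw [zpow_sub_one] at h3
        exact mul_inv_eq_one.1 h3
      rw [this]
  · rintro (rfl | rfl)
    · exact ⟨⟨1, one_mem _, by simp⟩, ⟨1, one_mem _, by simp⟩⟩
    · refine ⟨⟨b, Subgroup.mem_zpowers _, rfl⟩, ⟨a⁻¹, ⟨-1, by simp⟩, ?_⟩⟩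
      rw [← hT.right_mul_mul, ← mul_assoc, of_one_mul]

omit [IsFlatTriple (rotationStabilizer a b)] in
theorem of_one_ne (g : G) :
    of (rotationStabilizer a b) 1 g ≠ of (rotationStabilizer a b) 1 (g * b) := by
  intro h
  have h1 : g⁻¹ * (g * b) ∈ Subgroup.zpowers (a * b) := of_eq_of.1 h
  rw [inv_mul_cancel_left] at h1
  rcases hT.mem_zpowers_mul.1 h1 with h1 | h1
  · exact hT.right_ne_one h1
  · exact hT.left_ne_one (by simpa using h1)

-- Stated for a generator `c` of the stabilizer so as to serve vertices (`c = b`) and faces (`c =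
-- a⁻¹`) alike. The link is a closed walk: the `j`-element through `g * c ^ k`, the edge through it,
-- then the `j`-element through `g * c ^ (k - 1)`.
omit hT in
theorem link_connected {i j : Fin 3} (hi : i ≠ 1) (hj : j ≠ 1) (hij : i ≠ j) {c : G}
    (hc : rotationStabilizer a b i = Subgroup.zpowers c)
    (hcj : c * (a * b) ∈ rotationStabilizer a b j) (g : G) :
    ((incidenceGraph (CosetElem (rotationStabilizer a b))).induce
      ((incidenceGraph (CosetElem (rotationStabilizer a b))).neighborSet
        (of (rotationStabilizer a b) i g))).Connected := by
  set Γ := incidenceGraph (CosetElem (rotationStabilizer a b)) with hΓ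
  set S := Γ.neighborSet (of (rotationStabilizer a b) i g) with hS
  have hof : ∀ k : ℤ, of (rotationStabilizer a b) i (g * c ^ k) =
      of (rotationStabilizer a b) i g := fun k => of_eq_of.2 (by rw [hc]; exact ⟨-k, by simp⟩)
  have hmem : ∀ (l : Fin 3) (k : ℤ), i ≠ l → of (rotationStabilizer a b) l (g * c ^ k) ∈ S := by
    intro l k hl
    rw [hS, SimpleGraph.mem_neighborSet, ← hof k]
    exact adj_of hl _
  let N (k : ℤ) : S := ⟨_, hmem j k hij⟩
  let E (k : ℤ) : S := ⟨_, hmem 1 k hi⟩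
  have hNE : ∀ k, (Γ.induce S).Adj (N k) (E k) := fun k => adj_of hj _
  have hEN : ∀ k, (Γ.induce S).Adj (E k) (N (k - 1)) := by
    intro k
    have h1 : of (rotationStabilizer a b) j (g * c ^ k * (a * b)) =
        of (rotationStabilizer a b) j (g * c ^ (k - 1)) := by
      refine of_eq_of.2 ?_
      have h2 : (g * c ^ k * (a * b))⁻¹ * (g * c ^ (k - 1)) = (c * (a * b))⁻¹ := by
        rw [zpow_sub_one]; group
      rw [h2]
      exact inv_mem hcj
    have h2 := of_one_mul (a := a) (b := b) (g * c ^ k)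
    change Γ.Adj (of _ 1 (g * c ^ k)) (of _ j (g * c ^ (k - 1)))
    rw [← h1, ← h2]
    exact adj_of hj.symm _
  have hN : ∀ k : ℤ, (Γ.induce S).Reachable (N 0) (N k) := by
    intro k
    induction k using Int.induction_on with
    | zero => exact SimpleGraph.Reachable.refl _
    | succ n ih =>
      refine ih.trans ?_
      have h1 := (hNE (n + 1)).reachable.trans (hEN (n + 1)).reachable
      rw [add_sub_cancel_right] at h1
      exact h1.symm
    | pred n ih => exact ih.trans ((hNE _).reachable.trans (hEN _).reachable)
  rw [SimpleGraph.connected_iff_exists_forall_reachable]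
  refine ⟨N 0, ?_⟩
  rintro ⟨x, hx⟩
  obtain ⟨hr, hm⟩ := adj_iff.1 hx
  obtain ⟨h, hh, e⟩ := meets_of_iff.1 hm
  rw [hc] at hh
  obtain ⟨k, rfl⟩ := hh
  rw [rank_of] at hr
  rcases (by omega : x.rank = j ∨ x.rank = 1) with h1 | h1
  · rw [h1] at e
    have : (⟨x, hx⟩ : S) = N k := Subtype.ext e
    rw [this]
    exact hN k
  · rw [h1] at e
    have : (⟨x, hx⟩ : S) = E k := Subtype.ext e
    rw [this]
    exact (hN k).trans (hNE k).reachable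

theorem isPolyhedron : IsPolyhedron (CosetElem (rotationStabilizer a b)) where
  edge_vertices e he := hT.encard_incidentOfRank (by decide) he
  edge_faces e he := hT.encard_incidentOfRank (by decide) he
  diamond v f hv hf h := by
    obtain ⟨g, h1, h2⟩ := meets_of_rank hv hf
    rw [grade_eq] at hv hf
    rw [h1, h2, hv, hf, hT.incidentOfRank_inter, Set.encard_pair (hT.of_one_ne g)]
  connected := by
    rw [SimpleGraph.connected_iff_exists_forall_reachable]
    have h02 : ∀ g : G, (incidenceGraph (CosetElem (rotationStabilizer a b))).Reachable
        (of _ 0 1) (of _ 2 g) := fun g =>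
      (adj_iff.2 ⟨by simp, meets_of_zero_two _ _⟩ : SimpleGraph.Adj _ _ _).reachable
    refine ⟨of _ 0 1, fun x => ?_⟩
    obtain ⟨g, h⟩ := x.exists_of
    rw [h]
    by_cases h2 : x.rank = 2
    · rw [h2]
      exact h02 g
    · exact (h02 g).trans (adj_of (Ne.symm h2) g).reachable
  link_connected F hF := by
    obtain ⟨g, h⟩ := F.exists_of
    rw [grade_eq] at hF
    rw [h]
    rcases hF with h0 | h0 <;> rw [h0]
    · refine IsTightPair.link_connected (j := 2) (by decide) (by decide) (by decide) (c := b) rfl ?_ g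
      rw [hT.right_mul_mul]
      exact inv_mem (Subgroup.mem_zpowers a)
    · refine IsTightPair.link_connected (j := 0) (by decide) (by decide) (by decide) (c := a⁻¹) ?_ ?_ g
      · rw [Subgroup.zpowers_inv]; rfl
      · rw [inv_mul_cancel_left]
        exact Subgroup.mem_zpowers b

theorem hasSchlafliSymbol : HasSchlafliSymbol (CosetElem (rotationStabilizer a b)) p q :=
  ⟨fun _ hf => ⟨hT.encard_incidentOfRank (by decide) hf, hT.encard_incidentOfRank (by decide) hf⟩,
    fun _ hv => ⟨hT.encard_incidentOfRank (by decide) hv,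
      hT.encard_incidentOfRank (by decide) hv⟩⟩

omit hT in
/-- The flag with vertex and face through `g`, and with the edge through `g`. -/
def evenFlag (a b g : G) [IsFlatTriple (rotationStabilizer a b)] :
    PFlag (CosetElem (rotationStabilizer a b)) where
  elem i := of _ i g
  grade_elem i := rfl
  incident i j := by
    rcases lt_trichotomy i j with h | rfl | h
    · exact Or.inl (le_iff.2 (Or.inr ⟨h, meets_of_of _ _ _⟩))
    · exact Or.inl le_rfl
    · exact Or.inr (le_iff.2 (Or.inr ⟨h, meets_of_of _ _ _⟩))

omit hT in
theorem le_or_le_of_mem_incidentOfRank {P : Type*} [PartialOrder P] [GradeOrder (Fin 3) P]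
    {i : Fin 3} {x y : P} (h : y ∈ incidentOfRank i x) : x ≤ y ∨ y ≤ x := by
  have := h.2
  simp only [incidenceGraph, SimpleGraph.fromRel_adj] at this
  exact this.2

theorem of_one_mul_mem (g : G) : of (rotationStabilizer a b) 1 (g * b) ∈
    incidentOfRank 1 (of (rotationStabilizer a b) 0 g) ∩
      incidentOfRank 1 (of (rotationStabilizer a b) 2 g) := by
  rw [hT.incidentOfRank_inter]; simp

/-- The flag that differs from `evenFlag a b g` in its edge. -/
def oddFlag (g : G) : PFlag (CosetElem (rotationStabilizer a b)) where
  elem i := if i = 1 then of _ 1 (g * b) else of _ i g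
  grade_elem i := by split_ifs with h <;> simp [h, grade_eq]
  incident i j := by
    have h := hT.of_one_mul_mem g
    have h0 := le_or_le_of_mem_incidentOfRank h.1
    have h2 := le_or_le_of_mem_incidentOfRank h.2
    split_ifs with hi hj hj
    · exact Or.inl le_rfl
    · rcases (by omega : j = 0 ∨ j = 2) with rfl | rfl
      · exact h0.symm
      · exact h2.symm
    · rcases (by omega : i = 0 ∨ i = 2) with rfl | rfl
      · exact h0
      · exact h2
    · exact (evenFlag a b g).incident i j

/-- The vertex and face of a flag share a group element `g`, which leaves two choices for the edge.
-/
theorem flag_cases (Φ : PFlag (CosetElem (rotationStabilizer a b))) :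
    ∃ g, Φ = evenFlag a b g ∨ Φ = hT.oddFlag g := by
  have hr : ∀ i, (Φ.elem i).rank = i := Φ.grade_elem
  have hadj : ∀ i j, i ≠ j →
      (incidenceGraph (CosetElem (rotationStabilizer a b))).Adj (Φ.elem i) (Φ.elem j) := by
    intro i j hij
    simp only [incidenceGraph, SimpleGraph.fromRel_adj]
    refine ⟨fun h => hij ?_, Φ.incident i j⟩
    rw [← hr i, h, hr]
  obtain ⟨g, h0, h2⟩ := meets_of_rank (hr 0) (hr 2)
  rw [hr] at h0 h2
  have h1 : Φ.elem 1 ∈ incidentOfRank 1 (Φ.elem 0) ∩ incidentOfRank 1 (Φ.elem 2) :=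
    ⟨⟨hr 1, hadj _ _ (by decide)⟩, ⟨hr 1, hadj _ _ (by decide)⟩⟩
  rw [h0, h2, hT.incidentOfRank_inter] at h1
  refine ⟨g, h1.imp (fun h => ?_) (fun h => ?_)⟩ <;> ext1 <;> ext1 i <;> fin_cases i
  exacts [h0, h, h2, h0, h, h2]

omit [IsFlatTriple (rotationStabilizer a b)] in
theorem eq_of_of {i j : Fin 3} (hij : i ≠ j) {g h : G}
    (h0 : of (rotationStabilizer a b) i g = of (rotationStabilizer a b) i h)
    (h2 : of (rotationStabilizer a b) j g = of (rotationStabilizer a b) j h) : g = h :=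
  inv_mul_eq_one.1 (Subgroup.disjoint_def.1 (hT.rotationStabilizer_disjoint hij) (of_eq_of.1 h0)
    (of_eq_of.1 h2))

theorem evenFlag_inj {g h : G} (e : evenFlag a b g = evenFlag a b h) : g = h :=
  hT.eq_of_of (i := 0) (j := 2) (by decide) (congrArg (fun Φ => Φ.elem 0) e)
    (congrArg (fun Φ => Φ.elem 2) e)

theorem oddFlag_inj {g h : G} (e : hT.oddFlag g = hT.oddFlag h) : g = h :=
  hT.eq_of_of (i := 0) (j := 2) (by decide) (congrArg (fun Φ => Φ.elem 0) e)
    (congrArg (fun Φ => Φ.elem 2) e)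

theorem evenFlag_ne_oddFlag (g h : G) : evenFlag a b g ≠ hT.oddFlag h := by
  intro e
  have h1 := hT.eq_of_of (i := 0) (j := 2) (by decide) (congrArg (fun Φ => Φ.elem 0) e)
    (congrArg (fun Φ => Φ.elem 2) e)
  subst h1
  exact hT.of_one_ne _ (congrArg (fun Φ => Φ.elem 1) e)

theorem enatCard_flag : ENat.card (PFlag (CosetElem (rotationStabilizer a b))) =
    ((2 * p * q : ℕ) : ℕ∞) := by
  have hb : Function.Bijective (Sum.elim (fun g => evenFlag a b g) hT.oddFlag) := by
    constructor
    · rintro (g | g) (h | h) e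
      · exact congrArg _ (hT.evenFlag_inj e)
      · exact absurd e (hT.evenFlag_ne_oddFlag g h)
      · exact absurd e.symm (hT.evenFlag_ne_oddFlag h g)
      · exact congrArg _ (hT.oddFlag_inj e)
    · intro Φ
      obtain ⟨g, h | h⟩ := hT.flag_cases Φ
      · exact ⟨Sum.inl g, h.symm⟩
      · exact ⟨Sum.inr g, h.symm⟩
  rw [← ENat.card_congr (Equiv.ofBijective _ hb), ENat.card_sum, hT.enatCard]
  norm_cast
  ring

theorem isTight : IsTight (CosetElem (rotationStabilizer a b)) :=
  ⟨p, q, hT.hasSchlafliSymbol, hT.enatCard_flag⟩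

end IsTightPair

end TightPolyhedron

/-! ### Automorphisms and chirality -/

section Chirality

open AbsPoly

variable {G : Type} [Group G]

open CosetElem

/-- Left translation as an automorphism of the coset geometry. -/
def CosetElem.translate {H : Fin 3 → Subgroup G} [IsFlatTriple H] (k : G) :
    CosetElem H ≃o CosetElem H where
  toFun x := ⟨x.rank, k • x.coset⟩
  invFun x := ⟨x.rank, k⁻¹ • x.coset⟩
  left_inv x := by simp
  right_inv x := by simp
  map_rel_iff' {x y} := by
    obtain ⟨i, c⟩ := x
    obtain ⟨j, d⟩ := y
    have key : ∀ (k : G) (x y : CosetElem H), x ≤ y →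
        (⟨x.rank, k • x.coset⟩ : CosetElem H) ≤ ⟨y.rank, k • y.coset⟩ := by
      rintro k x y (rfl | ⟨h, g, h1, h2⟩)
      · exact le_rfl
      · refine le_iff.2 (Or.inr ⟨h, k * g, ?_, ?_⟩)
        · rw [h1]; rfl
        · rw [h2]; rfl
    refine ⟨fun h => ?_, key k _ _⟩
    simpa using key k⁻¹ _ _ h

@[simp] theorem CosetElem.translate_of {H : Fin 3 → Subgroup G} [IsFlatTriple H] (k : G)
    (i : Fin 3) (g : G) : translate k (of H i g) = of H i (k * g) := rfl

/-- Every element lies on a strict chain of three elements, and the ranks of its image can only be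
0, 1, 2. -/
theorem CosetElem.rank_map {H : Fin 3 → Subgroup G} [IsFlatTriple H]
    (φ : CosetElem H ≃o CosetElem H) (x : CosetElem H) : (φ x).rank = x.rank := by
  obtain ⟨g, h⟩ := x.exists_of
  have h01 : of H 0 g < of H 1 g := lt_iff.2 ⟨by simp, meets_of_of _ _ _⟩
  have h12 : of H 1 g < of H 2 g := lt_iff.2 ⟨by simp, meets_of_of _ _ _⟩
  have h1 := (lt_iff.1 (φ.lt_iff_lt.2 h01)).1
  have h2 := (lt_iff.1 (φ.lt_iff_lt.2 h12)).1
  have h3 : (φ (of H 0 g)).rank = 0 ∧ (φ (of H 1 g)).rank = 1 ∧ (φ (of H 2 g)).rank = 2 := by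
    omega
  rw [h]
  generalize x.rank = i
  fin_cases i
  exacts [h3.1, h3.2.1, h3.2.2]

theorem CosetElem.map_mem_incidentOfRank {H : Fin 3 → Subgroup G} [IsFlatTriple H]
    (φ : CosetElem H ≃o CosetElem H) {i : Fin 3} {x y : CosetElem H}
    (h : y ∈ incidentOfRank i x) : φ y ∈ incidentOfRank i (φ x) := by
  obtain ⟨h1, h2⟩ := h
  refine ⟨by rw [grade_eq, rank_map, ← grade_eq, h1], ?_⟩
  simp only [incidenceGraph, SimpleGraph.fromRel_adj, ne_eq, EmbeddingLike.apply_eq_iff_eq,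
    map_le_map_iff] at h2 ⊢
  exact h2

namespace IsTightPair

variable {a b : G} {p q : ℕ} (hT : IsTightPair a b p q)
include hT

variable [IsFlatTriple (rotationStabilizer a b)]

/-- The automorphism `φ` sends the even flag at `x` to the odd flag at `y`. -/
def MapsEvenToOdd (hT : IsTightPair a b p q)
    (φ : CosetElem (rotationStabilizer a b) ≃o CosetElem (rotationStabilizer a b))
    (x y : G) : Prop :=
  ∀ i, φ ((evenFlag a b x).elem i) = (hT.oddFlag y).elem i

variable {φ : CosetElem (rotationStabilizer a b) ≃o CosetElem (rotationStabilizer a b)}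

theorem mapsEvenToOdd_iff {x y : G} : hT.MapsEvenToOdd φ x y ↔
    φ (of _ 0 x) = of _ 0 y ∧ φ (of _ 1 x) = of _ 1 (y * b) ∧ φ (of _ 2 x) = of _ 2 y := by
  constructor
  · intro h
    exact ⟨h 0, h 1, h 2⟩
  · rintro ⟨h0, h1, h2⟩ i
    fin_cases i
    exacts [h0, h1, h2]

theorem exists_edge_map {x y : G} (h0 : φ (of _ 0 x) = of _ 0 y) (h2 : φ (of _ 2 x) = of _ 2 y) :
    (φ (of _ 1 x) = of _ 1 y ∧ φ (of _ 1 (x * b)) = of _ 1 (y * b)) ∨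
      (φ (of _ 1 x) = of _ 1 (y * b) ∧ φ (of _ 1 (x * b)) = of _ 1 y) := by
  have key : ∀ z, z ∈ incidentOfRank 1 (of (rotationStabilizer a b) 0 x) ∩
      incidentOfRank 1 (of (rotationStabilizer a b) 2 x) →
      φ z = of _ 1 y ∨ φ z = of _ 1 (y * b) := by
    intro z hz
    have h3 := map_mem_incidentOfRank φ hz.1
    have h4 := map_mem_incidentOfRank φ hz.2
    rw [h0] at h3
    rw [h2] at h4
    have h5 := Set.mem_inter h3 h4
    rw [hT.incidentOfRank_inter] at h5
    exact h5
  rw [hT.incidentOfRank_inter] at key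
  have hne : φ (of _ 1 x) ≠ φ (of _ 1 (x * b)) := fun e => hT.of_one_ne x (φ.injective e)
  rcases key _ (Or.inl rfl) with h3 | h3 <;> rcases key _ (Or.inr rfl) with h4 | h4
  · exact absurd (h3.trans h4.symm) hne
  · exact Or.inl ⟨h3, h4⟩
  · exact Or.inr ⟨h3, h4⟩
  · exact absurd (h3.trans h4.symm) hne

theorem end_map {j : Fin 3} (hj : j ≠ 1) {x y : G} (h1 : φ (of _ 1 x) = of _ 1 y)
    (h : φ (of _ j x) = of _ j y) : φ (of _ j (x * (a * b))) = of _ j (y * (a * b)) := by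
  have hmem : of _ j (x * (a * b)) ∈ incidentOfRank j (of (rotationStabilizer a b) 1 x) := by
    rw [hT.incidentOfRank_edge hj]; simp
  have h2 := map_mem_incidentOfRank φ hmem
  rw [h1, hT.incidentOfRank_edge hj] at h2
  rcases h2 with h2 | h2
  · have h3 := φ.injective (h2.trans h.symm)
    have h4 := of_eq_of.1 h3
    have h5 : (x * (a * b))⁻¹ * x = (a * b)⁻¹ := by group
    rw [h5] at h4
    have h6 := Subgroup.disjoint_def.1 (hT.rotationStabilizer_disjoint hj) h4
      (inv_mem (Subgroup.mem_zpowers (a * b)))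
    exact absurd (inv_eq_one.1 h6) hT.mul_ne_one
  · exact h2

/-- The face is unchanged. The vertex through `x * a` is the other end of the edge through `x`, so
it goes to the other end of the edge through `y * b`, which is the vertex through `y * b * (a * b) =
y * a⁻¹`. -/
theorem MapsEvenToOdd.mul_left {x y : G} (h : hT.MapsEvenToOdd φ x y) :
    hT.MapsEvenToOdd φ (x * a) (y * a⁻¹) := by
  rw [mapsEvenToOdd_iff] at h ⊢
  obtain ⟨h0, h1, h2⟩ := h
  have eb : ∀ z : G, of (rotationStabilizer a b) 0 (z * b) = of _ 0 z := fun z => by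
    simpa using of_zero_mul (a := a) (b := b) z 1
  have ea : ∀ z : G, of (rotationStabilizer a b) 2 (z * a) = of _ 2 z := fun z => by
    simpa using of_two_mul (a := a) (b := b) z 1
  have ea' : ∀ z : G, of (rotationStabilizer a b) 2 (z * a⁻¹) = of _ 2 z := fun z => by
    simpa using of_two_mul (a := a) (b := b) z (-1)
  have e1 : y * b * (a * b) = y * a⁻¹ := by rw [mul_assoc, hT.right_mul_mul]
  have h0' : φ (of _ 0 (x * a)) = of _ 0 (y * a⁻¹) := by
    have h3 := hT.end_map (φ := φ) (j := 0) (by decide) h1 (by rw [h0, eb])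
    rw [← mul_assoc, eb, e1] at h3
    exact h3
  have h2' : φ (of _ 2 (x * a)) = of _ 2 (y * a⁻¹) := by rw [ea, ea', h2]
  refine ⟨h0', ?_, h2'⟩
  rcases hT.exists_edge_map h0' h2' with ⟨-, h4⟩ | ⟨h4, -⟩
  · have h5 : φ (of _ 1 (x * a * b)) = of _ 1 (y * a⁻¹) := by
      rw [mul_assoc, of_one_mul, h1, ← e1, of_one_mul]
    exact absurd (h5.symm.trans h4) (hT.of_one_ne _)
  · exact h4

/-- Here the vertex is unchanged, the edge is exchanged within the diamond of the vertex and the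
face, and the new face is the one across the new edge. -/
theorem MapsEvenToOdd.mul_right {x y : G} (h : hT.MapsEvenToOdd φ x y) :
    hT.MapsEvenToOdd φ (x * b) (y * b⁻¹) := by
  rw [mapsEvenToOdd_iff] at h ⊢
  obtain ⟨h0, h1, h2⟩ := h
  have eb : ∀ z : G, of (rotationStabilizer a b) 0 (z * b) = of _ 0 z := fun z => by
    simpa using of_zero_mul (a := a) (b := b) z 1
  have eb' : ∀ z : G, of (rotationStabilizer a b) 0 (z * b⁻¹) = of _ 0 z := fun z => by
    simpa using of_zero_mul (a := a) (b := b) z (-1)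
  have ea : ∀ z : G, of (rotationStabilizer a b) 2 (z * a) = of _ 2 z := fun z => by
    simpa using of_two_mul (a := a) (b := b) z 1
  have ea' : ∀ z : G, of (rotationStabilizer a b) 2 (z * a⁻¹) = of _ 2 z := fun z => by
    simpa using of_two_mul (a := a) (b := b) z (-1)
  have h1' : φ (of _ 1 (x * b)) = of _ 1 y := by
    rcases hT.exists_edge_map h0 h2 with ⟨h4, -⟩ | ⟨-, h4⟩
    · exact absurd (h4.symm.trans h1) (hT.of_one_ne _)
    · exact h4
  refine ⟨by rw [eb, eb', h0], by rw [inv_mul_cancel_right, h1'], ?_⟩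
  have e1 : ∀ z : G, z * b⁻¹ * (a * b) * (a * b) = z * b⁻¹ := fun z => by
    rw [mul_assoc, hT.mul_mul_mul, mul_one]
  have e2 : x * b * (a * b) = x * a⁻¹ := by rw [mul_assoc, hT.right_mul_mul]
  have e3 : of (rotationStabilizer a b) 2 (y * (a * b)) = of _ 2 (y * b⁻¹) := by
    rw [hT.right_inv_eq, ← mul_assoc y (a * b) a, ea]
  have h3 := hT.end_map (φ := φ) (x := x * b * (a * b)) (y := y) (j := 2) (by decide)
    (by rw [of_one_mul, h1']) (by rw [e2, ea', h2])
  rw [mul_assoc (x * b), hT.mul_mul_mul, mul_one] at h3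
  rw [h3, e3]

/-- If no map of the group inverts both rotations, then no automorphism sends an even flag to an
odd flag. -/
theorem not_mapsEvenToOdd (hC : ∀ f : G → G, (∀ g, f (g * a) = f g * a⁻¹) →
    (∀ g, f (g * b) = f g * b⁻¹) → False) (x y : G) : ¬ hT.MapsEvenToOdd φ x y := by
  intro h
  have huniq : ∀ {x y z}, hT.MapsEvenToOdd φ x y → hT.MapsEvenToOdd φ x z → y = z := by
    intro x y z h1 h2
    rw [mapsEvenToOdd_iff] at h1 h2
    exact hT.eq_of_of (i := 0) (j := 2) (by decide) (h1.1.symm.trans h2.1)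
      (h1.2.2.symm.trans h2.2.2)
  have hpow : ∀ (c : G) (n : ℕ), 0 < n → orderOf c = n →
      (∀ x, (∃ y, hT.MapsEvenToOdd φ x y) → ∃ y, hT.MapsEvenToOdd φ (x * c) y) →
      ∀ (k : ℤ) x, (∃ y, hT.MapsEvenToOdd φ x y) → ∃ y, hT.MapsEvenToOdd φ (x * c ^ k) y := by
    -- As `c` has finite order, natural powers suffice and the step need not be inverted.
    intro c n hn hc hstep k x hx
    have hfin : IsOfFinOrder c := orderOf_pos_iff.1 (by omega)
    obtain ⟨l, hl'⟩ := hfin.mem_powers_iff_mem_zpowers.2 ⟨k, rfl⟩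
    have hl : c ^ l = c ^ k := hl'
    clear hl'
    rw [← hl]
    clear hl k
    induction l with
    | zero => simpa using hx
    | succ l ih => rw [pow_succ, ← mul_assoc]; exact hstep _ ih
  have hp := hT.one_lt_left
  have hq := hT.one_lt_right
  have hall : ∀ z, ∃ y, hT.MapsEvenToOdd φ z y := by
    intro z
    obtain ⟨i, j, e⟩ := hT.exists_zpow (x⁻¹ * z)
    have hz : z = x * a ^ i * b ^ j := by rw [mul_assoc, ← e]; group
    rw [hz]
    refine hpow b q (by omega) hT.orderOf_right
      (fun x ⟨y, hy⟩ => ⟨_, MapsEvenToOdd.mul_right hT hy⟩) _ _ ?_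
    exact hpow a p (by omega) hT.orderOf_left
      (fun x ⟨y, hy⟩ => ⟨_, MapsEvenToOdd.mul_left hT hy⟩) _ _ ⟨y, h⟩
  choose f hf using hall
  exact hC f (fun g => huniq (hf _) (MapsEvenToOdd.mul_left hT (hf g)))
    (fun g => huniq (hf _) (MapsEvenToOdd.mul_right hT (hf g)))

theorem isChiral (hC : ∀ f : G → G, (∀ g, f (g * a) = f g * a⁻¹) →
    (∀ g, f (g * b) = f g * b⁻¹) → False) : IsChiral (CosetElem (rotationStabilizer a b)) := by
  have hnot : ∀ g h, ¬ (evenFlag a b g).Equivalent (hT.oddFlag h) :=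
    fun g h ⟨φ, hφ⟩ => hT.not_mapsEvenToOdd (φ := φ) hC g h hφ
  have hsymm : ∀ {Φ Ψ : PFlag (CosetElem (rotationStabilizer a b))}, Φ.Equivalent Ψ →
      Ψ.Equivalent Φ := fun ⟨φ, h⟩ => ⟨φ.symm, fun i => by rw [← h]; simp⟩
  have hodd : ∀ g, ¬ ∃ h, hT.oddFlag g = evenFlag a b h :=
    fun g ⟨h, e⟩ => hT.evenFlag_ne_oddFlag _ _ e.symm
  refine ⟨{Φ | ∃ g, Φ = evenFlag a b g}, ?_, fun h => hnot 1 1 (h _ _), ?_⟩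
  · intro Φ Ψ
    obtain ⟨g, rfl | rfl⟩ := hT.flag_cases Φ <;> obtain ⟨h, rfl | rfl⟩ := hT.flag_cases Ψ
    · refine iff_of_true ⟨translate (h * g⁻¹), fun i => ?_⟩ (iff_of_true ⟨g, rfl⟩ ⟨h, rfl⟩)
      simp [evenFlag]
    · exact iff_of_false (hnot _ _) (fun e => hodd h (e.1 ⟨g, rfl⟩))
    · exact iff_of_false (fun e => hnot _ _ (hsymm e)) (fun e => hodd g (e.2 ⟨h, rfl⟩))
    · refine iff_of_true ⟨translate (h * g⁻¹), fun i => ?_⟩ (iff_of_false (hodd g) (hodd h))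
      simp only [oddFlag]
      split_ifs <;> simp [← mul_assoc]
  · intro Φ Ψ hadj
    obtain ⟨i, hi, hij⟩ := hadj
    obtain ⟨g, rfl | rfl⟩ := hT.flag_cases Φ <;> obtain ⟨h, rfl | rfl⟩ := hT.flag_cases Ψ
    · obtain ⟨j, k, hj, hk, hjk⟩ : ∃ j k : Fin 3, j ≠ i ∧ k ≠ i ∧ j ≠ k := by
        clear hi hij; revert i; decide
      have e := hT.eq_of_of hjk (hij j hj) (hij k hk)
      rw [e] at hi
      exact absurd rfl hi
    · exact iff_of_true ⟨g, rfl⟩ (hodd h)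
    · exact iff_of_false (hodd g) (not_not.2 ⟨h, rfl⟩)
    -- The edge of the odd flag at `g` is also the edge through `g * a⁻¹`, so it can be compared
    -- with the face at `g * a⁻¹` or with the vertex at `g * b`.
    · have e : g = h := by
        have eb : ∀ z : G, of (rotationStabilizer a b) 0 (z * b) = of _ 0 z := fun z => by
          simpa using of_zero_mul (a := a) (b := b) z 1
        have ea' : ∀ z : G, of (rotationStabilizer a b) 2 (z * a⁻¹) = of _ 2 z := fun z => by
          simpa using of_two_mul (a := a) (b := b) z (-1)
        have e1 : ∀ z : G, of (rotationStabilizer a b) 1 (z * b) = of _ 1 (z * a⁻¹) := fun z => by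
          rw [← hT.right_mul_mul, ← mul_assoc, of_one_mul]
        fin_cases i
        · have h1 : of _ 1 (g * b) = of _ 1 (h * b) := hij 1 (by decide)
          have h2 : of _ 2 g = of _ 2 h := hij 2 (by decide)
          rw [e1, e1] at h1
          exact mul_right_cancel (hT.eq_of_of (j := 2) (by decide) h1 (by rw [ea', ea', h2]))
        · exact hT.eq_of_of (i := 0) (j := 2) (by decide) (hij 0 (by decide))
            (hij 2 (by decide))
        · have h1 : of _ 1 (g * b) = of _ 1 (h * b) := hij 1 (by decide)
          have h0 : of _ 0 g = of _ 0 h := hij 0 (by decide)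
          exact mul_right_cancel (hT.eq_of_of (j := 0) (by decide) h1 (by rw [eb, eb, h0]))
      rw [e] at hi
      exact absurd rfl hi

end IsTightPair

end Chirality

/-! ### Generating, mixing and testing rotation groups -/

section RotationGroups

/-- A relation between powers of `a ^ P` and `b ^ Q` that fails for the inverses of `a` and `b`. -/
def HasAsymmetricRelation {G : Type} [Group G] (a b : G) (P Q : ℤ) : Prop :=
  ∃ i j k l : ℤ, b ^ (Q * j) * a ^ (P * i) = a ^ (P * k) * b ^ (Q * l) ∧
    b ^ (-(Q * j)) * a ^ (-(P * i)) ≠ a ^ (-(P * k)) * b ^ (-(Q * l))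

/-- A rotation pair whose powers permute, with odd powers of `a` arising from `a`. -/
structure IsPermutingPair {G : Type} [Group G] (a b : G) (p q : ℕ) : Prop
    extends IsRotationPair a b p q where
  exists_mul_eq : ∀ j : ℤ, ∃ i k : ℤ, b ^ j * a = a ^ (2 * i + 1) * b ^ k

/-- The subgroup generated by the pair. -/
abbrev rotationGroup {G : Type} [Group G] (a b : G) : Subgroup G := Subgroup.closure {a, b}

theorem left_mem_rotationGroup {G : Type} [Group G] (a b : G) : a ∈ rotationGroup a b :=
  Subgroup.subset_closure (by simp)

theorem right_mem_rotationGroup {G : Type} [Group G] (a b : G) : b ∈ rotationGroup a b :=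
  Subgroup.subset_closure (by simp)

theorem IsPermutingPair.exists_zpow_of_mem {G : Type} [Group G] {a b : G} {p q : ℕ}
    (hT : IsPermutingPair a b p q) {g : G} (hg : g ∈ rotationGroup a b) :
    ∃ i j : ℤ, g = a ^ i * b ^ j := by
  have ha : ∀ g : G, (∃ i j : ℤ, g = a ^ i * b ^ j) → ∃ i j : ℤ, g * a = a ^ i * b ^ j := by
    rintro g ⟨i, j, rfl⟩
    obtain ⟨i', k, h⟩ := hT.exists_mul_eq j
    exact ⟨i + (2 * i' + 1), k, by rw [mul_assoc, h, zpow_add _ i, mul_assoc]⟩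
  have han : ∀ (n : ℕ) (g : G), (∃ i j : ℤ, g = a ^ i * b ^ j) →
      ∃ i j : ℤ, g * a ^ n = a ^ i * b ^ j := by
    intro n
    induction n with
    | zero => intro g h; simpa using h
    | succ n ih => intro g h; rw [pow_succ, ← mul_assoc]; exact ha _ (ih g h)
  have hb : ∀ (g : G) (n : ℤ), (∃ i j : ℤ, g = a ^ i * b ^ j) →
      ∃ i j : ℤ, g * b ^ n = a ^ i * b ^ j := by
    rintro g n ⟨i, j, rfl⟩
    exact ⟨i, j + n, by rw [zpow_add, mul_assoc]⟩
  have hinv : a⁻¹ = a ^ (p - 1) := by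
    rw [inv_eq_iff_mul_eq_one, ← pow_succ', Nat.sub_add_cancel hT.one_lt_left.le,
      ← hT.orderOf_left, pow_orderOf_eq_one]
  induction hg using Subgroup.closure_induction_right with
  | one => exact ⟨0, 0, by simp⟩
  | mul_right x hx y hy ih =>
    rcases hy with rfl | rfl
    · exact ha _ ih
    · simpa using hb _ 1 ih
  | mul_inv_cancel x hx y hy ih =>
    rcases hy with rfl | rfl
    · rw [hinv]; exact han _ _ ih
    · simpa using hb _ (-1) ih

theorem IsPermutingPair.isTightPair {G : Type} [Group G] {a b : G} {p q : ℕ}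
    (hT : IsPermutingPair a b p q) :
    IsTightPair (⟨a, left_mem_rotationGroup a b⟩ : rotationGroup a b)
      ⟨b, right_mem_rotationGroup a b⟩ p q where
  orderOf_left := by rw [Subgroup.orderOf_mk, hT.orderOf_left]
  orderOf_right := by rw [Subgroup.orderOf_mk, hT.orderOf_right]
  one_lt_left := hT.one_lt_left
  one_lt_right := hT.one_lt_right
  mul_sq := Subtype.ext hT.mul_sq
  disjoint i j h := Subtype.ext (hT.disjoint i j (congrArg Subtype.val h))
  exists_zpow := by
    rintro ⟨g, hg⟩
    obtain ⟨i, j, h⟩ := hT.exists_zpow_of_mem hg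
    exact ⟨i, j, Subtype.ext h⟩

/-- The group admits no map that acts as a reflection inverting both rotations. -/
def NoInversion {G : Type} [Group G] (a b : G) : Prop :=
  ∀ f : G → G, (∀ g, f (g * a) = f g * a⁻¹) → (∀ g, f (g * b) = f g * b⁻¹) → False

theorem NoInversion.symm {G : Type} [Group G] {a b : G} (h : NoInversion a b) :
    NoInversion b a := fun f ha hb => h f hb ha

/-- A forbidden map sends a word to `f 1` times the same word with negated exponents, so it would
carry the relation to its negated form. -/
theorem HasAsymmetricRelation.noInversion {G : Type} [Group G] {a b : G} {P Q : ℤ}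
    (h : HasAsymmetricRelation a b P Q) :
    NoInversion (⟨a, left_mem_rotationGroup a b⟩ : rotationGroup a b)
      ⟨b, right_mem_rotationGroup a b⟩ := by
  intro f hfa hfb
  have key : ∀ c : rotationGroup a b, (∀ g, f (g * c) = f g * c⁻¹) →
      ∀ (n : ℤ) (g : rotationGroup a b), f (g * c ^ n) = f g * c ^ (-n) := by
    intro c hc n
    induction n using Int.induction_on with
    | zero => intro g; simp
    | succ n ih => intro g; rw [zpow_add_one, ← mul_assoc, hc, ih]; group
    | pred n ih =>
      intro g
      have h1 := hc (g * c ^ (-(n : ℤ) - 1))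
      rw [mul_assoc, ← zpow_add_one, sub_add_cancel, ih] at h1
      rw [eq_mul_inv_iff_mul_eq] at h1
      rw [← h1]
      group
  obtain ⟨i, j, k, l, h1, h2⟩ := h
  set a' : rotationGroup a b := ⟨a, left_mem_rotationGroup a b⟩
  set b' : rotationGroup a b := ⟨b, right_mem_rotationGroup a b⟩
  have e1 : b' ^ (Q * j) * a' ^ (P * i) = a' ^ (P * k) * b' ^ (Q * l) := Subtype.ext h1
  have e2 := congrArg (fun z => f (1 * z)) e1
  simp only [← mul_assoc, key a' hfa, key b' hfb] at e2
  rw [mul_assoc, mul_assoc] at e2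
  exact h2 (congrArg Subtype.val (mul_left_cancel e2))

theorem exists_chiral_of_isTightPair {G : Type} [Group G] {a b : G} {p q : ℕ}
    (hT : IsTightPair a b p q) (hC : NoInversion a b) :
    ∃ (P : Type) (_ : PartialOrder P) (_ : GradeOrder (Fin 3) P),
      AbsPoly.IsPolyhedron P ∧ AbsPoly.IsTight P ∧ AbsPoly.IsChiral P ∧
        AbsPoly.HasSchlafliSymbol P p q := by
  have := hT.isFlatTriple
  exact ⟨CosetElem (rotationStabilizer a b), inferInstance, inferInstance, hT.isPolyhedron,
    hT.isTight, hT.isChiral hC, hT.hasSchlafliSymbol⟩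

theorem exists_int_dvd_sub {m n : ℕ} (h : m.Coprime n) (x y : ℤ) :
    ∃ z : ℤ, (m : ℤ) ∣ z - x ∧ (n : ℤ) ∣ z - y := by
  obtain ⟨u, v, huv⟩ := Nat.isCoprime_iff_coprime.2 h
  refine ⟨x * (v * n) + y * (u * m), ⟨u * (y - x), ?_⟩, ⟨v * (x - y), ?_⟩⟩
  · linear_combination x * huv
  · linear_combination y * huv

/-- The mix of two permuting pairs whose half orders and orders are coprime. -/
theorem IsPermutingPair.prod {G K : Type} [Group G] [Group K] {a b : G} {c d : K}
    {p q p' q' : ℕ} (h : IsPermutingPair a b (2 * p) q) (h' : IsPermutingPair c d (2 * p') q')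
    (hp : p.Coprime p') (hq : q.Coprime q') :
    IsPermutingPair (a, c) (b, d) (2 * (p * p')) (q * q') where
  orderOf_left := by
    rw [Prod.orderOf, h.orderOf_left, h'.orderOf_left, Nat.lcm_mul_left, hp.lcm_eq_mul]
  orderOf_right := by
    rw [Prod.orderOf, h.orderOf_right, h'.orderOf_right, hq.lcm_eq_mul]
  one_lt_left := by
    have := h.one_lt_left
    have := h'.one_lt_left
    have : 0 < p * p' := Nat.mul_pos (by omega) (by omega)
    omega
  one_lt_right := one_lt_mul'' h.one_lt_right h'.one_lt_right
  mul_sq := Prod.ext h.mul_sq h'.mul_sq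
  disjoint i j e := Prod.ext (h.disjoint i j (congrArg Prod.fst e))
    (h'.disjoint i j (congrArg Prod.snd e))
  exists_mul_eq j := by
    obtain ⟨i, k, e⟩ := h.exists_mul_eq j
    obtain ⟨i', k', e'⟩ := h'.exists_mul_eq j
    -- The orders `2 * p` and `2 * p'` are not coprime, but both exponents of the left rotations are
    -- odd, so it suffices to match their halves modulo `p` and `p'`.
    obtain ⟨s, ⟨x, hx⟩, ⟨y, hy⟩⟩ := exists_int_dvd_sub hp i i'
    obtain ⟨t, ht, ht'⟩ := exists_int_dvd_sub hq k k'
    refine ⟨s, t, Prod.ext ?_ ?_⟩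
    · change b ^ j * a = a ^ (2 * s + 1) * b ^ t
      rw [e]
      congr 1 <;> rw [zpow_eq_zpow_iff_modEq, Int.modEq_iff_dvd]
      · rw [h.orderOf_left]
        exact ⟨x, by push_cast; linear_combination 2 * hx⟩
      · rw [h.orderOf_right]; exact ht
    · change d ^ j * c = c ^ (2 * s + 1) * d ^ t
      rw [e']
      congr 1 <;> rw [zpow_eq_zpow_iff_modEq, Int.modEq_iff_dvd]
      · rw [h'.orderOf_left]
        exact ⟨y, by push_cast; linear_combination 2 * hy⟩
      · rw [h'.orderOf_right]; exact ht'

/-- The exponents are multiples of the orders of `c` and `d`, so the second coordinate of the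
relation is trivial. -/
theorem HasAsymmetricRelation.prod {G K : Type} [Group G] [Group K] {a b : G} {c d : K} {P Q : ℕ}
    (h : HasAsymmetricRelation a b P Q) (hc : orderOf c = P) (hd : orderOf d = Q) :
    HasAsymmetricRelation (a, c) (b, d) P Q := by
  obtain ⟨i, j, k, l, h1, h2⟩ := h
  refine ⟨i, j, k, l, Prod.ext h1 ?_, fun e => h2 (congrArg Prod.fst e)⟩
  have hc1 : c ^ P = 1 := by rw [← hc, pow_orderOf_eq_one]
  have hd1 : d ^ Q = 1 := by rw [← hd, pow_orderOf_eq_one]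
  simp [zpow_mul, hc1, hd1]

theorem orderOf_eq_of_zpow_iff {G : Type} [Group G] {x : G} {n : ℕ}
    (h : ∀ i : ℤ, x ^ i = 1 ↔ (n : ℤ) ∣ i) : orderOf x = n := by
  apply Nat.dvd_antisymm
  · rw [← Int.natCast_dvd_natCast, orderOf_dvd_iff_zpow_eq_one, h]
  · rw [← Int.natCast_dvd_natCast, ← h, zpow_natCast, pow_orderOf_eq_one]

theorem DihedralGroup.sr_zpow_of_even {n : ℕ} (i : ZMod n) {k : ℤ} (hk : Even k) :
    (DihedralGroup.sr i) ^ k = 1 := by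
  rw [← orderOf_dvd_iff_zpow_eq_one, DihedralGroup.orderOf_sr]
  exact_mod_cast hk.two_dvd

theorem DihedralGroup.sr_zpow_of_odd {n : ℕ} (i : ZMod n) {k : ℤ} (hk : Odd k) :
    (DihedralGroup.sr i) ^ k = DihedralGroup.sr i := by
  obtain ⟨l, rfl⟩ := hk
  rw [zpow_add_one, DihedralGroup.sr_zpow_of_even i (even_two_mul l), one_mul]

open DihedralGroup in
/-- The rotations of a regular polyhedron of type `{2u, 2v}`. -/
theorem isPermutingPair_dihedral {u v : ℕ} (hu : 0 < u) (hv : 0 < v) :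
    IsPermutingPair ((r 1, sr 0) : DihedralGroup (2 * u) × DihedralGroup (2 * v))
      (sr 0, r 1) (2 * u) (2 * v) where
  orderOf_left := by
    rw [Prod.orderOf, orderOf_r_one, orderOf_sr, Nat.lcm_eq_left (dvd_mul_right 2 u)]
  orderOf_right := by
    rw [Prod.orderOf, orderOf_r_one, orderOf_sr, Nat.lcm_eq_right (dvd_mul_right 2 v)]
  one_lt_left := by omega
  one_lt_right := by omega
  mul_sq := by
    rw [sq]
    ext1 <;> simp
  disjoint i j h := by
    have h1 : (r 1 : DihedralGroup (2 * u)) ^ i = sr 0 ^ j := congrArg Prod.fst h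
    have h2 : (sr 0 : DihedralGroup (2 * v)) ^ i = r 1 ^ j := congrArg Prod.snd h
    ext1
    · change (r 1 : DihedralGroup (2 * u)) ^ i = 1
      rcases Int.even_or_odd j with hj | hj
      · rw [h1, sr_zpow_of_even _ hj]
      · rw [sr_zpow_of_odd _ hj, r_zpow] at h1
        exact nomatch h1
    · change (sr 0 : DihedralGroup (2 * v)) ^ i = 1
      rcases Int.even_or_odd i with hi | hi
      · rw [sr_zpow_of_even _ hi]
      · rw [sr_zpow_of_odd _ hi, r_zpow] at h2
        exact nomatch h2
  exists_mul_eq j := by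
    rcases Int.even_or_odd j with hj | hj
    · refine ⟨0, -j, Prod.ext ?_ ?_⟩
      · simp [sr_zpow_of_even _ hj]
      · simp
    · refine ⟨-1, -j, Prod.ext ?_ ?_⟩
      · simp [sr_zpow_of_odd _ hj]
      · simp

/-! ### Powers of the affine maps over a ring with `e * e = 0` -/

section AffineRotations

variable {R : Type} [CommRing R]

/-- Multiplication by `-(1 + e)`, where `e * e = 0`. -/
def linearRotation (e : R) (he : e * e = 0) : Equiv.Perm R where
  toFun x := -(1 + e) * x
  invFun x := -(1 - e) * x
  left_inv x := by linear_combination (-x) * he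
  right_inv x := by linear_combination (-x) * he

/-- The affine map `x ↦ (1 - e) * (x - 1)`, where `e * e = 0`. -/
def affineRotation (e : R) (he : e * e = 0) : Equiv.Perm R where
  toFun x := (1 - e) * (x - 1)
  invFun x := (1 + e) * x + 1
  left_inv x := by linear_combination (-(x - 1)) * he
  right_inv x := by linear_combination (-x) * he

variable (e : R) (he : e * e = 0)

theorem linearRotation_zpow_even (k : ℤ) (x : R) :
    (linearRotation e he ^ (2 * k)) x = (1 + 2 * k * e) * x := by
  rw [zpow_mul]
  induction k using Int.induction_on generalizing x with
  | zero => simp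
  | succ n ih =>
    rw [zpow_add_one, Equiv.Perm.mul_apply, ih]
    change _ * (-(1 + e) * (-(1 + e) * x)) = _
    push_cast
    linear_combination (x + 4 * n * x + 2 * n * e * x) * he
  | pred n ih =>
    rw [zpow_sub_one, Equiv.Perm.mul_apply, ih]
    change _ * (-(1 - e) * (-(1 - e) * x)) = _
    push_cast
    linear_combination (x + 4 * n * x - 2 * n * e * x) * he

theorem linearRotation_zpow_odd (k : ℤ) (x : R) :
    (linearRotation e he ^ (2 * k + 1)) x = -(1 + (2 * k + 1) * e) * x := by
  rw [zpow_add_one, Equiv.Perm.mul_apply, linearRotation_zpow_even]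
  change _ * (-(1 + e) * x) = _
  linear_combination (-2 * k * x) * he

theorem affineRotation_zpow {h : R} (hh : 2 * h = 1) (k : ℤ) (x : R) :
    (affineRotation e he ^ k) x = (1 - k * e) * x - k + e * h * k * (k + 1) := by
  induction k using Int.induction_on generalizing x with
  | zero => simp
  | succ n ih =>
    rw [zpow_add_one, Equiv.Perm.mul_apply, ih]
    change _ * ((1 - e) * (x - 1)) - _ + _ = _
    push_cast
    linear_combination (n * (x - 1)) * he - (n + 1) * e * hh
  | pred n ih =>
    rw [zpow_sub_one, Equiv.Perm.mul_apply, ih]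
    change _ * ((1 + e) * x + 1) - _ + _ = _
    push_cast
    linear_combination (n * x) * he - n * e * hh

end AffineRotations

end RotationGroups

/-! ### Chiral pairs of type `{2M, N}` with `N` odd -/

section ChiralPairs

/-- The arithmetic data of a chiral pair of type `{2M, N}`: the integer `E = N / m` squares to zero
modulo `N` and is nonzero. -/
structure ChiralData (m M N E : ℕ) : Prop where
  one_lt : 1 < m
  eq_mul : N = m * E
  dvd_quot : m ∣ E
  dvd_left : m ∣ M
  dvd : M ∣ N
  odd : Odd N

theorem mul_fst_apply {X K : Type} [Group K] (g h : Equiv.Perm X × K) (x : X) :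
    (g * h).1 x = g.1 (h.1 x) := rfl

namespace ChiralData

variable {m M N E : ℕ} (hD : ChiralData m M N E)
include hD

theorem quot_sq : (E : ZMod N) * E = 0 := by
  obtain ⟨c, hc⟩ := hD.dvd_quot
  have : E * E = N * c := by
    rw [hD.eq_mul]; nth_rewrite 2 [hc]; ring
  rw [← Nat.cast_mul, this]
  simp

theorem left_mul_quot : (M : ZMod N) * E = 0 := by
  obtain ⟨c, hc⟩ := hD.dvd_left
  have : M * E = N * c := by rw [hD.eq_mul, hc]; ring
  rw [← Nat.cast_mul, this]
  simp

theorem quot_pos : 0 < E := by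
  rcases Nat.eq_zero_or_pos E with h | h
  · have := hD.odd
    rw [hD.eq_mul, h] at this
    simp at this
  · exact h

theorem quot_ne_zero : (E : ZMod N) ≠ 0 := by
  rw [Ne, ZMod.natCast_eq_zero_iff, hD.eq_mul]
  intro h
  have := Nat.le_of_dvd hD.quot_pos h
  nlinarith [hD.quot_pos, hD.one_lt]

theorem exists_half : ∃ h : ZMod N, 2 * h = 1 := by
  obtain ⟨c, hc⟩ := hD.odd
  refine ⟨-c, ?_⟩
  have : ((2 * c + 1 : ℕ) : ZMod N) = 0 := by rw [← hc]; simp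
  push_cast at this
  linear_combination -this

theorem one_lt_right : 1 < N := by
  have := hD.one_lt
  have := hD.quot_pos
  rw [hD.eq_mul]
  exact lt_of_lt_of_le hD.one_lt (Nat.le_mul_of_pos_right _ this)

/-- The rotation of order `2M`. -/
def left (hD : ChiralData m M N E) : Equiv.Perm (ZMod N) × Multiplicative (ZMod M) :=
  (linearRotation (E : ZMod N) hD.quot_sq, Multiplicative.ofAdd 1)

/-- The rotation of order `N`. -/
def right (hD : ChiralData m M N E) : Equiv.Perm (ZMod N) × Multiplicative (ZMod M) :=
  (affineRotation (E : ZMod N) hD.quot_sq, Multiplicative.ofAdd (-1))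

theorem left_zpow_even_apply (k : ℤ) (x : ZMod N) :
    (hD.left ^ (2 * k)).1 x = (1 + 2 * k * E) * x :=
  linearRotation_zpow_even _ hD.quot_sq k x

theorem left_zpow_odd_apply (k : ℤ) (x : ZMod N) :
    (hD.left ^ (2 * k + 1)).1 x = -(1 + (2 * k + 1) * E) * x :=
  linearRotation_zpow_odd _ hD.quot_sq k x

theorem right_zpow_apply {h : ZMod N} (hh : 2 * h = 1) (k : ℤ) (x : ZMod N) :
    (hD.right ^ k).1 x = (1 - k * E) * x - k + E * h * k * (k + 1) :=
  affineRotation_zpow _ hD.quot_sq hh k x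

theorem left_zpow_snd (k : ℤ) : (hD.left ^ k).2 = Multiplicative.ofAdd (k : ZMod M) := by
  simp [left, ← ofAdd_zsmul]

theorem right_zpow_snd (k : ℤ) : (hD.right ^ k).2 = Multiplicative.ofAdd (-k : ZMod M) := by
  simp [right, ← ofAdd_zsmul]

theorem left_zpow_eq_one_iff (i : ℤ) : hD.left ^ i = 1 ↔ ((2 * M : ℕ) : ℤ) ∣ i := by
  obtain ⟨h, hh⟩ := hD.exists_half
  constructor
  · intro H
    have h2 := hD.left_zpow_snd i
    rw [H] at h2
    have hM : (M : ℤ) ∣ i := by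
      rw [← ZMod.intCast_zmod_eq_zero_iff_dvd]
      exact (Multiplicative.ofAdd.injective h2).symm
    obtain ⟨k, rfl | rfl⟩ := i.even_or_odd'
    · have hodd : Nat.Coprime M 2 := (hD.odd.of_dvd_nat hD.dvd).coprime_two_right
      push_cast
      exact mul_dvd_mul_left 2 ((Nat.isCoprime_iff_coprime.2 hodd).dvd_of_dvd_mul_left hM)
    · exfalso
      have h1 := hD.left_zpow_odd_apply k 1
      rw [H] at h1
      have h1 : (1 : ZMod N) = -(1 + (2 * k + 1) * E) * 1 := h1
      refine hD.quot_ne_zero ?_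
      -- Multiplying by `E` kills the `E`-term and gives `E = -E`, hence `E = 0` because 2 is
      -- invertible.
      linear_combination (h * E) * h1 - E * hh - h * (2 * k + 1) * hD.quot_sq
  · rintro ⟨t, rfl⟩
    have e : ((2 * M : ℕ) : ℤ) * t = 2 * (M * t) := by push_cast; ring
    refine Prod.ext (Equiv.ext fun x => ?_) ?_
    · rw [e, left_zpow_even_apply]
      push_cast
      change _ = x
      linear_combination (2 * t * x) * hD.left_mul_quot
    · rw [left_zpow_snd]
      simp

theorem right_zpow_eq_one {k : ℤ} (hk : (N : ℤ) ∣ k) : hD.right ^ k = 1 := by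
  obtain ⟨h, hh⟩ := hD.exists_half
  have h1 := (ZMod.intCast_zmod_eq_zero_iff_dvd k N).2 hk
  have h2 := (ZMod.intCast_zmod_eq_zero_iff_dvd k M).2
    ((Int.natCast_dvd_natCast.2 hD.dvd).trans hk)
  refine Prod.ext (Equiv.ext fun x => ?_) ?_
  · rw [hD.right_zpow_apply hh, h1]
    simp
  · rw [right_zpow_snd, h2]
    simp

/-- The image of 0 is `-k` plus a multiple of `E * k`; multiplying by `E` gives `E * k = 0`, hence
`k = 0`. Since powers of the left rotation fix 0, this also yields the trivial intersection. -/
theorem dvd_of_right_zpow_apply {k : ℤ} (hk : (hD.right ^ k).1 0 = 0) : (N : ℤ) ∣ k := by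
  obtain ⟨h, hh⟩ := hD.exists_half
  rw [hD.right_zpow_apply hh] at hk
  rw [← ZMod.intCast_zmod_eq_zero_iff_dvd]
  have he : (E : ZMod N) * k = 0 := by
    linear_combination (-(E : ZMod N)) * hk + (h * k * (k + 1)) * hD.quot_sq
  linear_combination -hk + (h * (k + 1)) * he

theorem left_zpow_apply_zero (i : ℤ) : (hD.left ^ i).1 0 = 0 := by
  obtain ⟨k, rfl | rfl⟩ := i.even_or_odd'
  · rw [left_zpow_even_apply, mul_zero]
  · rw [left_zpow_odd_apply, mul_zero]

theorem left_pos : 0 < M := Nat.pos_of_dvd_of_pos hD.dvd (by have := hD.one_lt_right; omega)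

theorem isPermutingPair : IsPermutingPair hD.left hD.right (2 * M) N where
  orderOf_left := orderOf_eq_of_zpow_iff hD.left_zpow_eq_one_iff
  orderOf_right := orderOf_eq_of_zpow_iff fun k =>
    ⟨fun H => hD.dvd_of_right_zpow_apply (by rw [H]; rfl), hD.right_zpow_eq_one⟩
  one_lt_left := by have := hD.left_pos; omega
  one_lt_right := hD.one_lt_right
  mul_sq := by
    refine Prod.ext (Equiv.ext fun x => ?_) ?_
    · have key : ∀ x, (hD.left * hD.right).1 x = 1 - x := by
        intro x
        change -(1 + (E : ZMod N)) * ((1 - E) * (x - 1)) = _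
        linear_combination (x - 1) * hD.quot_sq
      rw [sq]
      change (hD.left * hD.right).1 ((hD.left * hD.right).1 x) = x
      rw [key, key, sub_sub_cancel]
    · change (Multiplicative.ofAdd (1 : ZMod M) * Multiplicative.ofAdd (-1)) ^ 2 = 1
      rw [← ofAdd_add]
      simp
  disjoint i j H := by
    rw [H]
    refine hD.right_zpow_eq_one (hD.dvd_of_right_zpow_apply ?_)
    rw [← H, left_zpow_apply_zero]
  exists_mul_eq j := by
    obtain ⟨h, hh⟩ := hD.exists_half
    obtain ⟨t, ht⟩ := Int.even_mul_pred_self j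
    have ht' : (j : ZMod N) * (j - 1) = t + t := by
      exact_mod_cast congrArg (Int.cast (R := ZMod N)) ht
    -- Comparing images of 0, with `2 * t = j * (j - 1)`, gives the exponent of the right rotation;
    -- the `ZMod M` coordinate then gives that of the left one.
    refine ⟨-j - E * t, -j - 2 * E * t, Prod.ext (Equiv.ext fun x => ?_) ?_⟩
    · change (hD.right ^ j).1 (hD.left.1 x) = (hD.left ^ (2 * (-j - E * t) + 1)).1
        ((hD.right ^ (-j - 2 * E * t)).1 x)
      rw [left_zpow_odd_apply, hD.right_zpow_apply hh, hD.right_zpow_apply hh]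
      have he := hD.quot_sq
      change _ * (-(1 + (E : ZMod N)) * x) - _ + _ = _
      push_cast
      generalize (E : ZMod N) = e at *
      generalize (j : ZMod N) = j at *
      generalize (t : ZMod N) = t at *
      have h1 : (2 * (-j - e * t) + 1) * e = e - 2 * j * e := by linear_combination (-2 * t) * he
      have h2 : (-j - 2 * e * t) * e = -j * e := by linear_combination (-2 * t) * he
      have h3 : e * h * (-j - 2 * e * t) * (-j - 2 * e * t + 1) = e * h * j * (j - 1) := by
        linear_combination (h * (2 * t * j + 2 * t * (j + 2 * e * t - 1))) * he
      rw [h1, h2, h3]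
      linear_combination ((2 * j - 2 * j ^ 2) * x + (1 - 2 * j) * (2 * t + h * j * (j - 1))) * he +
        e * j ^ 2 * hh - e * ht'
    · change (hD.right ^ j).2 * Multiplicative.ofAdd 1 = (hD.left ^ (2 * (-j - E * t) + 1)).2 *
        (hD.right ^ (-j - 2 * E * t)).2
      rw [left_zpow_snd, right_zpow_snd, right_zpow_snd, ← ofAdd_add, ← ofAdd_add]
      congr 1
      push_cast
      ring

theorem hasAsymmetricRelation {u v : ℕ} (hu : u.Coprime m) (hv : v.Coprime m) :
    HasAsymmetricRelation hD.left hD.right ((2 * u : ℕ) : ℤ) ((2 * v : ℕ) : ℤ) := by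
  obtain ⟨h, hh⟩ := hD.exists_half
  have he := hD.quot_sq
  -- The correction to the right exponent absorbs the stretching of the translation by `1 + 2 * u *
  -- E`. The correction to the left exponent acts trivially on `ZMod N`, as `E * E = 0`, and only
  -- balances the `ZMod M` coordinate.
  refine ⟨1, 1, 1 - 2 * v * E, 1 - 2 * u * E, Prod.ext (Equiv.ext fun x => ?_) ?_, fun H => ?_⟩
  · rw [mul_fst_apply, mul_fst_apply,
      show ((2 * u : ℕ) : ℤ) * 1 = 2 * u by push_cast; ring,
      show ((2 * u : ℕ) : ℤ) * (1 - 2 * v * E) = 2 * (u - 2 * u * v * E) by push_cast; ring,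
      left_zpow_even_apply, left_zpow_even_apply, hD.right_zpow_apply hh, hD.right_zpow_apply hh]
    push_cast
    generalize (E : ZMod N) = e at *
    generalize (u : ZMod N) = u at *
    generalize (v : ZMod N) = v at *
    have h1 : 2 * (u - 2 * u * v * e) * e = 2 * u * e := by
      linear_combination (-4 * u * v) * he
    have h2 : (2 * v * (1 - 2 * u * e)) * e = 2 * v * e := by
      linear_combination (-4 * u * v) * he
    rw [h1, h2]
    linear_combination (-(8 * v * u ^ 2 +
      2 * u * (h * (2 * v * (1 - 2 * u * e)) * (2 * v * (1 - 2 * u * e) + 1)) +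
      h * (2 * v) * (-2 * u * (2 * v * (1 - 2 * u * e) + 1) - 4 * u * v))) * he
  · change (hD.right ^ _).2 * (hD.left ^ _).2 = (hD.left ^ _).2 * (hD.right ^ _).2
    rw [left_zpow_snd, right_zpow_snd, left_zpow_snd, right_zpow_snd, ← ofAdd_add, ← ofAdd_add]
    congr 1
    push_cast
    ring
  · have H1 := congrArg (fun z => z.1 0) H
    rw [mul_fst_apply, mul_fst_apply, left_zpow_apply_zero,
      show -(((2 * u : ℕ) : ℤ) * (1 - 2 * v * E)) = 2 * (2 * u * v * E - u) by push_cast; ring,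
      left_zpow_even_apply, hD.right_zpow_apply hh, hD.right_zpow_apply hh] at H1
    have H2 : ((E * (u * v) : ℕ) : ZMod N) = 0 := by
      push_cast at H1 ⊢
      generalize (E : ZMod N) = e at *
      generalize (u : ZMod N) = u at *
      generalize (v : ZMod N) = v at *
      set l := 2 * v * (1 - 2 * u * e) with hl
      -- With negated exponents the two contributions `4 * u * v * e` add instead of cancelling: at
      -- 0 the relation reads `8 * u * v * e = 0`, and `h ^ 3` inverts the 8.
      linear_combination h ^ 3 * H1 + h ^ 3 * (-4 * u * v * h * (l - 1 + 2 * v) + 8 * u ^ 2 * v -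
        2 * u * h * l * (l - 1) + 4 * u * v * (l + e * h * l * (l - 1))) * he -
        e * u * v * (4 * h ^ 2 + 2 * h + 1) * hh
    rw [ZMod.natCast_eq_zero_iff, hD.eq_mul, mul_comm m] at H2
    have H3 := Nat.dvd_of_mul_dvd_mul_left hD.quot_pos H2
    have H4 := Nat.Coprime.eq_one_of_dvd (Nat.Coprime.mul_left hu hv).symm H3
    have := hD.one_lt
    omega

end ChiralData

end ChiralPairs

/-! ### Assembling the required types -/

theorem ChiralData.exists_isTightPair {m M N E : ℕ} (hD : ChiralData m M N E) :
    ∃ (G : Type) (_ : Group G) (a b : G), IsTightPair a b (2 * M) N ∧ NoInversion a b := by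
  have h : HasAsymmetricRelation hD.left hD.right ((2 * 1 : ℕ) : ℤ) ((2 * 1 : ℕ) : ℤ) :=
    hD.hasAsymmetricRelation (Nat.coprime_one_left m) (Nat.coprime_one_left m)
  exact ⟨_, inferInstance, _, _, hD.isPermutingPair.isTightPair, h.noInversion⟩

theorem ChiralData.exists_isTightPair_mix {m M N E u v : ℕ} (hD : ChiralData m M N E)
    (hu : 0 < u) (hv : 0 < v) (hum : M.Coprime u) (hvm : N.Coprime (2 * v)) :
    ∃ (G : Type) (_ : Group G) (a b : G),
      IsTightPair a b (2 * (M * u)) (N * (2 * v)) ∧ NoInversion a b := by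
  have hR := isPermutingPair_dihedral hu hv
  have hmu : u.Coprime m := (Nat.Coprime.coprime_dvd_left hD.dvd_left hum).symm
  have hmN : m ∣ N := hD.eq_mul ▸ dvd_mul_right m E
  have hmv : v.Coprime m :=
    (Nat.Coprime.coprime_dvd_left hmN (Nat.Coprime.coprime_dvd_right (dvd_mul_left v 2) hvm)).symm
  have h := hD.hasAsymmetricRelation hmu hmv
  exact ⟨_, inferInstance, _, _, (hD.isPermutingPair.prod hR hum hvm).isTightPair,
    (h.prod hR.orderOf_left hR.orderOf_right).noInversion⟩

theorem chiralData_pow {m : ℕ} (hm : 1 < m) (hm2 : Odd m) {k l : ℕ} (hk : 1 ≤ k) (hkl : k ≤ l)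
    (hl : 2 ≤ l) : ChiralData m (m ^ k) (m ^ l) (m ^ (l - 1)) where
  one_lt := hm
  eq_mul := by rw [← pow_succ', Nat.sub_add_cancel (by omega)]
  dvd_quot := dvd_pow_self m (by omega)
  dvd_left := dvd_pow_self m (by omega)
  dvd := pow_dvd_pow m hkl
  odd := hm2.pow

theorem mainTheorem10 (m r s : ℕ) (hm : m.Prime) (hm2 : Odd m) (hr : 0 < r) (hs : 0 < s)
    (h : Even s ∨ (Odd s ∧ r ∣ s * m)) :
    ∃ (P : Type) (_ : PartialOrder P) (_ : GradeOrder (Fin 3) P),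
      AbsPoly.IsPolyhedron P ∧ AbsPoly.IsTight P ∧ AbsPoly.IsChiral P ∧
        AbsPoly.HasSchlafliSymbol P (2 * r * m) (s * m ^ 2) := by
  suffices H : ∃ (G : Type) (_ : Group G) (a b : G),
      IsTightPair a b (2 * r * m) (s * m ^ 2) ∧ NoInversion a b by
    obtain ⟨G, _, a, b, hT, hC⟩ := H
    exact exists_chiral_of_isTightPair hT hC
  rcases h with h | ⟨hs2, hrs⟩
  · obtain ⟨e, r', hr', rfl⟩ := Nat.exists_eq_pow_mul_and_not_dvd hr.ne' m hm.ne_one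
    obtain ⟨f, s', hs', rfl⟩ := Nat.exists_eq_pow_mul_and_not_dvd hs.ne' m hm.ne_one
    have h2 : Even s' := (Nat.even_mul.1 h).resolve_left (by
      rw [Nat.not_even_iff_odd]; exact hm2.pow)
    obtain ⟨v, hv⟩ := h2.two_dvd
    have hcr : m.Coprime r' := (hm.coprime_iff_not_dvd).2 hr'
    have hcs : m.Coprime s' := (hm.coprime_iff_not_dvd).2 hs'
    have hr0 : 0 < r' := Nat.pos_of_mul_pos_left hr
    have hs0 : 0 < s' := Nat.pos_of_mul_pos_left hs
    have hcv : m.Coprime v := Nat.Coprime.coprime_dvd_right ⟨2, by omega⟩ hcs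
    have hc2 : m.Coprime (2 * r') := Nat.Coprime.mul_right hm2.coprime_two_right hcr
    rw [hv] at hcs
    subst hv
    -- The `m`-parts of `r * m` and `s * m ^ 2` are `m ^ (e + 1)` and `m ^ (f + 2)`. The chiral
    -- factor needs `M ∣ N`, so the smaller power serves as `M`; in the second case the dual
    -- polyhedron is built and the rotations are swapped.
    rcases le_or_gt e (f + 1) with hef | hef
    · obtain ⟨G, i, a, b, hT, hC⟩ :=
        (chiralData_pow hm.one_lt hm2 (k := e + 1) (l := f + 2) (by omega) (by omega)
          (by omega)).exists_isTightPair_mix hr0 (v := v) (by omega) (hcr.pow_left _)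
          (hcs.pow_left _)
      refine ⟨G, i, a, b, ?_, hC⟩
      convert hT using 1 <;> ring
    · obtain ⟨G, i, a, b, hT, hC⟩ :=
        (chiralData_pow hm.one_lt hm2 (k := f + 2) (l := e + 1) (by omega) (by omega)
          (by omega)).exists_isTightPair_mix (u := v) (by omega) hr0 (hcv.pow_left _)
          (hc2.pow_left _)
      refine ⟨G, i, b, a, ?_, hC.symm⟩
      convert hT.symm using 1 <;> ring
  -- Here `s * m ^ 2` is odd and `r ∣ s * m` is what gives `M ∣ N`, so no mixing is needed.
  · have hD : ChiralData m (r * m) (s * m ^ 2) (s * m) :=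
      { one_lt := hm.one_lt
        eq_mul := by ring
        dvd_quot := dvd_mul_left m s
        dvd_left := dvd_mul_left m r
        dvd := by
          rw [sq, ← mul_assoc]
          exact mul_dvd_mul_right hrs m
        odd := hs2.mul hm2.pow }
    obtain ⟨G, i, a, b, hT, hC⟩ := hD.exists_isTightPair
    exact ⟨G, i, a, b, by rwa [mul_assoc], hC⟩
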